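/- Let $(\Omega,\mathcal F,(\mathcal F_t)_{t\ge 0},\mathbb P)$ be a filtered probability space carrying a two-dimensional $(\mathcal F_t)$-Brownian motion $\mathbf W=(W_1,W_2)$ with continuous paths. Let $\mu_X,\mu_Y,r\in\mathbb R$, $\sigma_X,\sigma_Y>0$ and $\kappa>0$, write $\mathbb R_+=(0,\infty)$, and for $(x,y)\in\mathbb R_+^2$ let $X$ and $Y$ be the geometric Brownian motions, continuous and adapted, that solve $$dX_t=\mu_XX_t\,dt+\sigma_XX_t\,dW_{1t},\quad X_0=x,\qquad dY_t=\mu_YY_t\,dt+\sigma_YY_t\,dW_{2t},\quad Y_0=y .$$ Let $\mathcal P^\kappa$ be the set of all probability measures $\mathbb Q$ on $(\Omega,\mathcal F)$ for which there is a progressively measurable process $\boldsymbol\theta=(\theta_1,\theta_2)$ with $|\theta_{it}|\le\kappa$ for all $t\ge0$ and $i=1,2$ such that for every $t\ge 0$ the restriction of $\mathbb Q$ to $\mathcal F_t$ has, with respect to the restriction of $\mathbb P$ to $\mathcal F_t$, the density $$\mathcal M_t^{\boldsymbol\theta}=\exp\Big(-\int_0^t\boldsymbol\theta_s\,d\mathbf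 W_s-\tfrac12\int_0^t\|\boldsymbol\theta_s\|^2\,ds\Big).$$ Let $\mathcal T$ be the set of all $(\mathcal F_t)$-stopping times with values in $[0,\infty]$. For a measurable function $F:\mathbb R_+^2\to[0,\infty)$ and $(x,y)\in\mathbb R_+^2$ define, with values in $[0,\infty]$, $$V_\kappa(x,y)=\sup_{\tau\in\mathcal T}\inf_{\mathbb Q\in\mathcal P^\kappa}\mathbb E^{\mathbb Q}\big[e^{-r\tau}F(X_\tau,Y_\tau)\mathbf 1_{\{\tau<\infty\}}\big],\qquad V_0(x,y)=\sup_{\tau\in\mathcal T}\mathbb E^{\mathbb P}\big[e^{-r\tau}F(X_\tau,Y_\tau)\mathbf 1_{\{\tau<\infty\}}\big],$$ and the continuation regions $$C_\kappa=\{(x,y)\in\mathbb R_+^2:V_\kappa(x,y)>F(x,y)\},\qquad C_0=\{(x,y)\in\mathbb R_+^2:V_0(x,y)>F(x,y)\}.$$ Then $V_\kappa(x,y)\le V_0(x,y)$ for all $(x,y)\in\mathbb R_+^2$, and $C_\kappa\subseteq C_0$. -/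

import Mathlib

open MeasureTheory ProbabilityTheory Filter Topology
open scoped NNReal ENNReal

noncomputable section

namespace AmbiguousStopping

variable {Ω : Type*} {mΩ : MeasurableSpace Ω}

/-- `W = (W 0, W 1)` is a two-dimensional standard Brownian motion under `P`, relative to the
filtration `𝓕`: two independent real Brownian motions with continuous paths, adapted to `𝓕`, whose
joint increments after time `s` are independent of `𝓕 s`. -/
structure IsBrownianMotion2 (𝓕 : Filtration ℝ≥0 mΩ) (P : Measure Ω)
    (W : Fin 2 → ℝ≥0 → Ω → ℝ) : Prop where
  brownian : ∀ i, IsBrownianReal (W i) P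
  indep : IndepFun (fun ω t => W 0 t ω) (fun ω t => W 1 t ω) P
  continuous_paths : ∀ i ω, Continuous fun t => W i t ω
  adapted : ∀ i, Adapted 𝓕 (W i)
  indep_past : ∀ s t, s ≤ t →
    Indep (MeasurableSpace.comap (fun ω i => W i t ω - W i s ω) MeasurableSpace.pi) (𝓕 s) P

/-- A simple (elementary) process: on `(time k, time (k + 1)]`, `k < n`, it takes the bounded
`𝓕 (time k)`-measurable random value `ξ k`, and it vanishes elsewhere. -/
structure SimpleProcess (𝓕 : Filtration ℝ≥0 mΩ) where
  /-- number of intervals -/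
  n : ℕ
  /-- partition points -/
  time : ℕ → ℝ≥0
  /-- random heights -/
  ξ : ℕ → Ω → ℝ
  mono : Monotone time
  meas : ∀ k, Measurable[𝓕 (time k)] (ξ k)
  bdd : ∃ C : ℝ, ∀ k ω, |ξ k ω| ≤ C

namespace SimpleProcess

variable {𝓕 : Filtration ℝ≥0 mΩ}

/-- The value of the simple process at time `s`. -/
def val (S : SimpleProcess 𝓕) (s : ℝ≥0) (ω : Ω) : ℝ :=
  ∑ k ∈ Finset.range S.n,
    (Set.Ioc (S.time k) (S.time (k + 1))).indicator (fun _ => S.ξ k ω) s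

/-- The elementary stochastic integral `∫₀ᵗ S dB`. -/
def integral (S : SimpleProcess 𝓕) (B : ℝ≥0 → Ω → ℝ) (t : ℝ≥0) (ω : Ω) : ℝ :=
  ∑ k ∈ Finset.range S.n,
    S.ξ k ω * (B (min (S.time (k + 1)) t) ω - B (min (S.time k) t) ω)

end SimpleProcess

/-- `I` is (a version with a.s. continuous paths of) the Itô integral process `t ↦ ∫₀ᵗ H dB` under
`P`: `H` is progressively measurable and a.s. locally square integrable in time, and there are
simple processes `S n` with `∫₀ᵀ (S n - H)² ds → 0` in probability for every `T`, whose elementary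
integrals at every time `t` converge in probability to `I t`. -/
structure IsItoIntegral (𝓕 : Filtration ℝ≥0 mΩ) (P : Measure Ω) (B H I : ℝ≥0 → Ω → ℝ) :
    Prop where
  progressive : IsProgressive 𝓕 H
  sq_integrable : ∀ᵐ ω ∂P, ∀ T : ℝ≥0,
    ∫⁻ s in Set.Ioc 0 (T : ℝ), ENNReal.ofReal (H s.toNNReal ω ^ 2) < ∞
  continuous_paths : ∀ᵐ ω ∂P, Continuous fun t => I t ω
  approx : ∃ S : ℕ → SimpleProcess 𝓕,
    (∀ T : ℝ≥0, ∀ ε : ℝ≥0∞, 0 < ε → Tendsto (fun n =>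
      P {ω | ε ≤ ∫⁻ s in Set.Ioc 0 (T : ℝ),
        ENNReal.ofReal (((S n).val s.toNNReal ω - H s.toNNReal ω) ^ 2)})
      atTop (𝓝 0)) ∧
    ∀ t : ℝ≥0, TendstoInMeasure P (fun n => (S n).integral B t) atTop (I t)

/-- `X` is a (strong, continuous) solution of `dX = μ X dt + σ X dB`, `X₀ = x`, under `P`. -/
structure IsGeometricBM (𝓕 : Filtration ℝ≥0 mΩ) (P : Measure Ω) (B : ℝ≥0 → Ω → ℝ)
    (μ σ x : ℝ) (X : ℝ≥0 → Ω → ℝ) : Prop where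
  adapted : Adapted 𝓕 X
  continuous_paths : ∀ ω, Continuous fun t => X t ω
  sde : ∃ I : ℝ≥0 → Ω → ℝ, IsItoIntegral 𝓕 P B (fun s ω => σ * X s ω) I ∧
    ∀ t : ℝ≥0, ∀ᵐ ω ∂P, X t ω = x + (∫ s in (0 : ℝ)..t, μ * X s.toNNReal ω) + I t ω

/-- `M` is the exponential density process
`M t = exp (-∫₀ᵗ θ · dW - (1/2) ∫₀ᵗ ‖θ‖² ds)`. -/
def IsDensityProcess (𝓕 : Filtration ℝ≥0 mΩ) (P : Measure Ω) (W θ : Fin 2 → ℝ≥0 → Ω → ℝ)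
    (M : ℝ≥0 → Ω → ℝ) : Prop :=
  ∃ I : Fin 2 → ℝ≥0 → Ω → ℝ, (∀ i, IsItoIntegral 𝓕 P (W i) (θ i) (I i)) ∧
    ∀ t ω, M t ω =
      Real.exp (-(∑ i, I i t ω) - 1 / 2 * ∫ s in (0 : ℝ)..t, ∑ i, θ i s.toNNReal ω ^ 2)

/-- The set of priors `𝒫^κ`: the probability measures `Q` for which there is a progressively
measurable `θ` with `|θ i| ≤ κ`, whose density process `M` satisfies `dQ/dP = M t` on `𝓕 t` for
every `t`. As `M t > 0`, `Q` and `P` are then equivalent on every `𝓕 t`. -/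
def priors (𝓕 : Filtration ℝ≥0 mΩ) (P : Measure Ω) (W : Fin 2 → ℝ≥0 → Ω → ℝ) (κ : ℝ) :
    Set (Measure Ω) :=
  {Q | IsProbabilityMeasure Q ∧ ∃ (θ : Fin 2 → ℝ≥0 → Ω → ℝ) (M : ℝ≥0 → Ω → ℝ),
    (∀ i, IsProgressive 𝓕 (θ i)) ∧ (∀ i t ω, |θ i t ω| ≤ κ) ∧ IsDensityProcess 𝓕 P W θ M ∧
    ∀ (t : ℝ≥0) (A : Set Ω), MeasurableSet[𝓕 t] A →
      Q A = ∫⁻ ω in A, ENNReal.ofReal (M t ω) ∂P}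

/-- `E^Q [e^{-rτ} F(X_τ, Y_τ) 1_{τ < ∞}] ∈ [0, ∞]`. -/
def expectedReward (Q : Measure Ω) (r : ℝ) (F : ℝ × ℝ → ℝ) (X Y : ℝ≥0 → Ω → ℝ)
    (τ : Ω → WithTop ℝ≥0) : ℝ≥0∞ :=
  ∫⁻ ω, {ω | τ ω < ⊤}.indicator (fun ω => ENNReal.ofReal
    (Real.exp (-r * ((τ ω).untopA : ℝ≥0)) * F (stoppedValue X τ ω, stoppedValue Y τ ω))) ω ∂Q

/-- The value `sup_τ inf_{Q ∈ 𝒫^κ} E^Q [e^{-rτ} F(X_τ, Y_τ) 1_{τ < ∞}]` under `κ`-ambiguity. -/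
def ambiguousValue (𝓕 : Filtration ℝ≥0 mΩ) (P : Measure Ω) (W : Fin 2 → ℝ≥0 → Ω → ℝ) (κ r : ℝ)
    (F : ℝ × ℝ → ℝ) (X Y : ℝ≥0 → Ω → ℝ) : ℝ≥0∞ :=
  ⨆ (τ : Ω → WithTop ℝ≥0) (_ : IsStoppingTime 𝓕 τ), ⨅ Q ∈ priors 𝓕 P W κ,
    expectedReward Q r F X Y τ

/-- The value `sup_τ E^P [e^{-rτ} F(X_τ, Y_τ) 1_{τ < ∞}]` without ambiguity. -/
def unambiguousValue (𝓕 : Filtration ℝ≥0 mΩ) (P : Measure Ω) (r : ℝ) (F : ℝ × ℝ → ℝ)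
    (X Y : ℝ≥0 → Ω → ℝ) : ℝ≥0∞ :=
  ⨆ (τ : Ω → WithTop ℝ≥0) (_ : IsStoppingTime 𝓕 τ), expectedReward P r F X Y τ

/-- The state space: pairs of positive reals. -/
def quadrant : Set (ℝ × ℝ) := Set.Ioi 0 ×ˢ Set.Ioi 0

/-- The continuation region `{p : V p > F p}` of a value function `V` with reward `F`. -/
def continuationRegion (V : ℝ × ℝ → ℝ≥0∞) (F : ℝ × ℝ → ℝ) : Set (ℝ × ℝ) :=
  {p | p ∈ quadrant ∧ ENNReal.ofReal (F p) < V p}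

end AmbiguousStopping

end

/-! The reference measure `P` is itself one of the priors: the kernel `θ = 0` is progressive and
bounded by `κ`, its Itô integrals vanish, and so its density process is constantly `1`
(`self_mem_priors`). Hence, for each stopping time, the infimum of the expected rewards over all
priors is at most the expected reward under `P`. The supremum over stopping times preserves this
inequality, and a larger value function has a larger continuation region. -/

namespace AmbiguousStopping

variable {Ω : Type*} {mΩ : MeasurableSpace Ω}

/-- The simple process without intervals, which vanishes identically. -/
def SimpleProcess.zero (𝓕 : Filtration ℝ≥0 mΩ) : SimpleProcess 𝓕 where
  n := 0
  time := fun _ => 0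
  ξ := fun _ _ => 0
  mono := monotone_const
  meas := fun _ => measurable_const
  bdd := ⟨0, fun _ _ => by simp⟩

lemma isItoIntegral_zero (𝓕 : Filtration ℝ≥0 mΩ) (P : Measure Ω) (B : ℝ≥0 → Ω → ℝ) :
    IsItoIntegral 𝓕 P B (fun _ _ => 0) (fun _ _ => 0) where
  progressive := fun _ => measurable_const
  sq_integrable := by simp
  continuous_paths := Eventually.of_forall fun _ => continuous_const
  approx := by
    refine ⟨fun _ => SimpleProcess.zero 𝓕, fun T ε hε => ?_, fun t ε hε => ?_⟩
    · simp [SimpleProcess.val, SimpleProcess.zero, hε.ne']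
    · simp [SimpleProcess.integral, SimpleProcess.zero, hε.ne']

lemma self_mem_priors (𝓕 : Filtration ℝ≥0 mΩ) (P : Measure Ω) [IsProbabilityMeasure P]
    (W : Fin 2 → ℝ≥0 → Ω → ℝ) {κ : ℝ} (hκ : 0 ≤ κ) : P ∈ priors 𝓕 P W κ := by
  refine ⟨inferInstance, fun _ _ _ => 0, fun _ _ => 1, fun _ _ => measurable_const,
    fun _ _ _ => by simpa using hκ,
    ⟨fun _ _ _ => 0, fun i => isItoIntegral_zero 𝓕 P (W i), fun t ω => by simp⟩,
    fun t A _ => by simp⟩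

lemma ambiguousValue_le_unambiguousValue (𝓕 : Filtration ℝ≥0 mΩ) (P : Measure Ω)
    [IsProbabilityMeasure P] (W : Fin 2 → ℝ≥0 → Ω → ℝ) {κ : ℝ} (hκ : 0 ≤ κ) (r : ℝ)
    (F : ℝ × ℝ → ℝ) (X Y : ℝ≥0 → Ω → ℝ) :
    ambiguousValue 𝓕 P W κ r F X Y ≤ unambiguousValue 𝓕 P r F X Y :=
  iSup₂_mono fun _ _ => iInf₂_le P (self_mem_priors 𝓕 P W hκ)

lemma continuationRegion_mono {V V' : ℝ × ℝ → ℝ≥0∞} (h : ∀ p, V p ≤ V' p) (F : ℝ × ℝ → ℝ) :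
    continuationRegion V F ⊆ continuationRegion V' F :=
  fun p hp => ⟨hp.1, hp.2.trans_le (h p)⟩

end AmbiguousStopping

/-- Ambiguity lowers the value of the stopping problem and shrinks the continuation region.
`X x` and `Y y` are the geometric Brownian motions started at `x` and `y`. -/
theorem lemma1 {Ω : Type*} {mΩ : MeasurableSpace Ω} (P : Measure Ω) [IsProbabilityMeasure P]
    (𝓕 : Filtration ℝ≥0 mΩ) (W : Fin 2 → ℝ≥0 → Ω → ℝ)
    (hW : AmbiguousStopping.IsBrownianMotion2 𝓕 P W)
    (μX μY σX σY r κ : ℝ) (hσX : 0 < σX) (hσY : 0 < σY) (hκ : 0 < κ)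
    (X Y : ℝ → ℝ≥0 → Ω → ℝ)
    (hX : ∀ x : ℝ, 0 < x → AmbiguousStopping.IsGeometricBM 𝓕 P (W 0) μX σX x (X x))
    (hY : ∀ y : ℝ, 0 < y → AmbiguousStopping.IsGeometricBM 𝓕 P (W 1) μY σY y (Y y))
    (F : ℝ × ℝ → ℝ) (hF : Measurable fun p : AmbiguousStopping.quadrant => F p)
    (hF_nonneg : ∀ p ∈ AmbiguousStopping.quadrant, 0 ≤ F p) :
    (∀ x y : ℝ, 0 < x → 0 < y →
      AmbiguousStopping.ambiguousValue 𝓕 P W κ r F (X x) (Y y) ≤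
        AmbiguousStopping.unambiguousValue 𝓕 P r F (X x) (Y y)) ∧
    AmbiguousStopping.continuationRegion
        (fun p => AmbiguousStopping.ambiguousValue 𝓕 P W κ r F (X p.1) (Y p.2)) F ⊆
      AmbiguousStopping.continuationRegion
        (fun p => AmbiguousStopping.unambiguousValue 𝓕 P r F (X p.1) (Y p.2)) F :=
  ⟨fun x y _ _ => AmbiguousStopping.ambiguousValue_le_unambiguousValue 𝓕 P W hκ.le r F (X x) (Y y),
    AmbiguousStopping.continuationRegion_mono (fun p =>
      AmbiguousStopping.ambiguousValue_le_unambiguousValue 𝓕 P W hκ.le r F (X p.1) (Y p.2)) F⟩
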